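/- Let $\Sigma$ be a finite linearly ordered alphabet, and order $\Sigma^*$ by radix order: $u<v$ if $|u|<|v|$, or $|u|=|v|$ and $u = xay$, $v = xbz$ for some words $x,y,z$ and letters $a<b$. For a language $L\subseteq\Sigma^*$ let $$S(L)=\{u\in L : \text{for all } v\in L,\ v<u \implies |v|<|u|\}$$ be the set of the smallest words of each length in $L$. A DFA is a complete deterministic finite automaton (every state has exactly one successor for each letter). **Theorem.** There is a function $f:\mathbb{N}\to\mathbb{R}$ with $f(n)=O(\sqrt{n\log n})$ as $n\to\infty$ such that, for every finite linearly ordered alphabet $\Sigma$, every $n$, and every language $L\subseteq\Sigma^*$ recognized by a DFA with $n$ states, the language $S(L)$ is recognized by a DFA with at most $2^{f(n)}$ states. The function $f$ does not depend on $\Sigma$ or on $L$. -/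

import Mathlib

open Asymptotics Filter

/-- `S(L)`: the words of `L` that are smallest in radix order (length first, then lexicographic)
among all words of `L` of the same length. -/
def smallestWords {α : Type*} [LinearOrder α] (L : Language α) : Language α :=
  {u | u ∈ L ∧ ∀ v ∈ L, List.Shortlex (· < ·) v u → v.length < u.length}

/-- `L` is recognized by a (complete) DFA with exactly `n` states. -/
def RecognizedByDFA {α : Type*} (L : Language α) (n : ℕ) : Prop :=
  ∃ (σ : Type) (_ : Fintype σ) (M : DFA α σ), Fintype.card σ = n ∧ M.accepts = L

/-! Let `live k` be the set of states accepting some word of length `k`. The smallest word of length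
`N` is read greedily: with `k` letters still to follow, take the least letter leading into `live k`.
Two periodicities make this tame. The sets `live k` have an eventual period `p`
(`DFA.live_eventually_periodic`), so `p` greedy steps act as a fixed self-map of the states, whose
iterates have an eventual period `c` (`DFA.greedyState_eventually_periodic`). With `P = c * p`, the
smallest word of length `N + P` is that of length `N` with a block of length `P` inserted at a fixed
position `D` (`DFA.mem_smallestWords_iff_cut`). Hence quotients by long words reduce to quotients by
short prefixes of greedy words, and Myhill–Nerode bounds the states by a polynomial in `n` and
`landauBound n`.

Both periods are lcms of cycle lengths of sum at most `n`, hence `exp (O(√(n log n)))`: lengths up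
to `X ≈ √(n log n)` divide `lcmUpto X`, which Chebyshev bounds, and at most `n / X` are larger. -/

/-! ### Walks in a finite digraph -/

/-- `Steps E k a b`: there is a walk of length `k` from `a` to `b` along the relation `E`. -/
def Steps {Q : Type*} (E : Q → Q → Prop) : ℕ → Q → Q → Prop
  | 0, a, b => a = b
  | k + 1, a, b => ∃ c, E a c ∧ Steps E k c b

namespace Steps

variable {Q : Type*} {E : Q → Q → Prop}

theorem trans {j k : ℕ} {a b c : Q} (h₁ : Steps E j a b) (h₂ : Steps E k b c) :
    Steps E (j + k) a c := by
  induction j generalizing a with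
  | zero => obtain rfl : a = b := h₁; simpa using h₂
  | succ j ih =>
    obtain ⟨d, hd, h⟩ := h₁
    rw [Nat.add_right_comm]
    exact ⟨d, hd, ih h⟩

theorem mul_left {k : ℕ} {a : Q} (h : Steps E k a a) (m : ℕ) : Steps E (m * k) a a := by
  induction m with
  | zero => rw [Nat.zero_mul]; exact rfl
  | succ m ih => rw [Nat.succ_mul]; exact ih.trans h

theorem of_dvd {k p : ℕ} {a : Q} (h : Steps E k a a) (hk : k ∣ p) : Steps E p a a := by
  obtain ⟨m, rfl⟩ := hk
  rw [Nat.mul_comm]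
  exact h.mul_left m

theorem exists_vertices {k : ℕ} {a b : Q} (h : Steps E k a b) :
    ∃ v : ℕ → Q, v 0 = a ∧ v k = b ∧
      ∀ i d, i + d ≤ k → Steps E d (v i) (v (i + d)) := by
  suffices H : ∃ v : ℕ → Q, v 0 = a ∧ v k = b ∧ ∀ i, i < k → E (v i) (v (i + 1)) by
    obtain ⟨v, h0, hk, hE⟩ := H
    refine ⟨v, h0, hk, fun i d => ?_⟩
    induction d generalizing i with
    | zero => intro _; exact rfl
    | succ d ih =>
      intro hd
      refine ⟨v (i + 1), hE i (by omega), ?_⟩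
      rw [show i + (d + 1) = i + 1 + d by omega]
      exact ih (i + 1) (by omega)
  induction k generalizing a with
  | zero =>
    obtain rfl : a = b := h
    exact ⟨fun _ => a, rfl, rfl, fun i hi => absurd hi (Nat.not_lt_zero i)⟩
  | succ k ih =>
    obtain ⟨c, hc, h⟩ := h
    obtain ⟨v, h0, hk, hE⟩ := ih h
    refine ⟨fun i => Nat.casesOn i a v, rfl, hk, fun i hi => ?_⟩
    cases i with
    | zero => simpa [h0] using hc
    | succ i => exact hE i (by omega)

theorem iff_iterate {f : Q → Q} {k : ℕ} {a b : Q} :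
    Steps (fun x y => f x = y) k a b ↔ f^[k] a = b := by
  induction k generalizing a with
  | zero => exact Iff.rfl
  | succ k ih => simp [Steps, ih]

/-- Closed walk lengths attached to a vertex set of total size at least their sum, chosen maximal:
every sufficiently long walk meets the vertex set. -/
theorem exists_hitting_cycles [Fintype Q] (E : Q → Q → Prop) :
    ∃ (S : Set Q) (c : Multiset ℕ), c.sum ≤ Fintype.card Q ∧ 0 ∉ c ∧
      (∀ v ∈ S, ∃ l ∈ c, Steps E l v v) ∧
      ∀ k a b, Fintype.card Q ≤ k → Steps E k a b →
        ∃ i j v, v ∈ S ∧ i + j = k ∧ Steps E i a v ∧ Steps E j v b := by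
  classical
  let good : Finset Q → Prop := fun S => ∃ c : Multiset ℕ, c.sum ≤ S.card ∧ 0 ∉ c ∧
    ∀ v ∈ S, ∃ l ∈ c, Steps E l v v
  obtain ⟨S, hSm⟩ := (Set.toFinite {S | good S}).exists_maximal ⟨∅, 0, by simp⟩
  obtain ⟨c, hc, hc0, hcS⟩ := hSm.prop
  refine ⟨S, c, hc.trans (Finset.card_le_univ S), hc0, hcS, fun k a b hk h => ?_⟩
  obtain ⟨v, h0, hkb, hv⟩ := h.exists_vertices
  suffices H : ∃ i ≤ k, v i ∈ S by
    obtain ⟨i, hi, hiS⟩ := H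
    refine ⟨i, k - i, v i, hiS, by omega, ?_, ?_⟩
    · simpa [h0] using hv 0 i (by omega)
    · simpa [hkb, Nat.add_sub_of_le hi] using hv i (k - i) (by omega)
  by_contra! hS
  have hrep : ∃ d, 0 < d ∧ ∃ i, i + d ≤ k ∧ v i = v (i + d) := by
    obtain ⟨x, y, hxy, he⟩ := Fintype.exists_ne_map_eq_of_card_lt
      (fun i : Fin (k + 1) => v i) (by simp; omega)
    rcases lt_or_gt_of_ne hxy with h' | h'
    · refine ⟨y - x, by omega, x, by omega, ?_⟩
      rw [show (x : ℕ) + (y - x) = y by omega]; exact he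
    · refine ⟨x - y, by omega, y, by omega, ?_⟩
      rw [show (y : ℕ) + (x - y) = x by omega]; exact he.symm
  -- A shortest return visits distinct vertices, so this loop off `S` adds exactly `d` to both the
  -- length sum and the cardinality, against maximality.
  obtain ⟨hd0, i, hik, hi⟩ := Nat.find_spec hrep
  have hmin := fun d => Nat.find_min hrep (m := d)
  generalize Nat.find hrep = d at hd0 hik hi hmin
  have hinj : Set.InjOn v (Finset.Ico i (i + d) : Set ℕ) := by
    have key : ∀ x y, i ≤ x → x < y → y < i + d → v x ≠ v y := fun x y hx hxy hy he =>
      hmin (y - x) (by omega) ⟨by omega, x, by omega, by rwa [Nat.add_sub_of_le hxy.le]⟩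
    intro x hx y hy he
    simp only [Finset.coe_Ico, Set.mem_Ico] at hx hy
    rcases lt_trichotomy x y with h' | h' | h'
    · exact absurd he (key x y hx.1 h' hy.2)
    · exact h'
    · exact absurd he.symm (key y x hy.1 h' hx.2)
  set D := (Finset.Ico i (i + d)).image v with hD
  have hDcard : D.card = d := by simp [hD, Finset.card_image_of_injOn hinj]
  have hdisj : Disjoint S D := by
    rw [Finset.disjoint_right]
    intro x hx
    obtain ⟨t, ht, rfl⟩ := Finset.mem_image.1 hx
    exact hS t (by have := Finset.mem_Ico.1 ht; omega)
  have hgood : good (S ∪ D) := by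
    refine ⟨d ::ₘ c, ?_, ?_, fun x hx => ?_⟩
    · rw [Finset.card_union_of_disjoint hdisj, hDcard, Multiset.sum_cons]; omega
    · simp only [Multiset.mem_cons, not_or]; exact ⟨by omega, hc0⟩
    · rcases Finset.mem_union.1 hx with hx | hx
      · obtain ⟨l, hl, h'⟩ := hcS x hx
        exact ⟨l, Multiset.mem_cons_of_mem hl, h'⟩
      · obtain ⟨t, ht, rfl⟩ := Finset.mem_image.1 hx
        have ht := Finset.mem_Ico.1 ht
        refine ⟨d, Multiset.mem_cons_self d c, ?_⟩
        have h₁ := hv t (i + d - t) (by omega)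
        have h₂ := hv i (t - i) (by omega)
        rw [Nat.add_sub_of_le (by omega), ← hi] at h₁
        rw [Nat.add_sub_of_le ht.1] at h₂
        have := h₁.trans h₂
        rwa [show i + d - t + (t - i) = d by omega] at this
  have hle : D ⊆ S := Finset.subset_union_right.trans
    (hSm.le_of_ge hgood Finset.subset_union_left)
  have : v i ∈ D := Finset.mem_image_of_mem v (by simp; omega)
  exact Finset.disjoint_left.1 hdisj (hle this) this

end Steps

/-! ### Landau-type bounds and periods -/

theorem Multiset.card_mul_le_sum_of_le {c : Multiset ℕ} {X : ℕ} (h : ∀ x ∈ c, X ≤ x) :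
    c.card * X ≤ c.sum := by
  simpa using Multiset.card_nsmul_le_sum h

/-- The least common multiple of positive integers of sum at most `n`. -/
theorem Multiset.lcm_le_lcmUpto_mul_pow {c : Multiset ℕ} {n X : ℕ} (hn : 0 < n) (hX : 0 < X)
    (hc : c.sum ≤ n) (h0 : 0 ∉ c) : c.lcm ≤ Nat.lcmUpto X * n ^ (n / X) := by
  set b := c.filter (X < ·) with hb
  have hbc : b ≤ c := Multiset.filter_le _ c
  have hsum : b.sum ≤ n := by
    obtain ⟨d, hd⟩ := Multiset.le_iff_exists_add.1 hbc
    rw [hd, Multiset.sum_add] at hc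
    omega
  have hcard : b.card ≤ n / X := by
    rw [Nat.le_div_iff_mul_le hX]
    refine (Multiset.card_mul_le_sum_of_le fun x hx => ?_).trans hsum
    exact (Multiset.mem_filter.1 hx).2.le
  have hprod : b.prod ≤ n ^ b.card :=
    Multiset.prod_le_pow_card b n fun x hx => (Multiset.le_sum_of_mem hx).trans hsum
  have hpos : 0 < b.prod :=
    Multiset.prod_pos fun x hx => Nat.pos_of_ne_zero fun h => h0 (h ▸ Multiset.mem_of_le hbc hx)
  have hdvd : c.lcm ∣ Nat.lcmUpto X * b.prod := by
    refine Multiset.lcm_dvd.2 fun x hx => ?_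
    by_cases hxX : X < x
    · exact (Multiset.dvd_prod (Multiset.mem_filter.2 ⟨hx, hxX⟩)).mul_left _
    · refine Dvd.dvd.mul_right ?_ _
      have hx0 : x ≠ 0 := fun h => h0 (h ▸ hx)
      exact Finset.dvd_lcm (f := id) (Finset.mem_Icc.2 ⟨by omega, by omega⟩)
  calc c.lcm ≤ Nat.lcmUpto X * b.prod :=
        Nat.le_of_dvd (Nat.mul_pos (Nat.lcmUpto_pos X) hpos) hdvd
    _ ≤ Nat.lcmUpto X * n ^ (n / X) :=
        Nat.mul_le_mul_left _ (hprod.trans (Nat.pow_le_pow_right hn hcard))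

/-- An upper bound for the maximal order of a permutation of `n` points. -/
noncomputable def landauBound (n : ℕ) : ℕ :=
  Nat.lcmUpto (⌊√((n : ℝ) * Real.log n)⌋₊ + 1) *
    n ^ (n / (⌊√((n : ℝ) * Real.log n)⌋₊ + 1))

/-- A long walk meets a vertex on a closed walk whose length divides the lcm `p`; loop there for `p`
more steps. -/
theorem Steps.exists_period {Q : Type*} [Fintype Q] [Nonempty Q] (E : Q → Q → Prop) :
    ∃ p, 0 < p ∧ p ≤ landauBound (Fintype.card Q) ∧
      ∀ k a b, Fintype.card Q ≤ k → Steps E k a b → Steps E (k + p) a b := by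
  obtain ⟨S, c, hc, hc0, hcS, hhit⟩ := Steps.exists_hitting_cycles E
  refine ⟨c.lcm, Nat.pos_of_ne_zero ((Multiset.lcm_ne_zero_iff c).2 hc0),
    Multiset.lcm_le_lcmUpto_mul_pow Fintype.card_pos (Nat.succ_pos _) hc hc0,
    fun k a b hk h => ?_⟩
  obtain ⟨i, j, v, hvS, rfl, h₁, h₂⟩ := hhit k a b hk h
  obtain ⟨l, hl, hv⟩ := hcS v hvS
  have := (h₁.trans (hv.of_dvd (Multiset.dvd_lcm hl))).trans h₂
  rwa [Nat.add_right_comm] at this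

theorem Function.exists_iterate_period {Q : Type*} [Fintype Q] [Nonempty Q] (f : Q → Q) :
    ∃ p, 0 < p ∧ p ≤ landauBound (Fintype.card Q) ∧
      f^[Fintype.card Q + p] = f^[Fintype.card Q] := by
  obtain ⟨p, hp, hpl, h⟩ := Steps.exists_period fun x y => f x = y
  exact ⟨p, hp, hpl, funext fun x =>
    Steps.iff_iterate.1 (h _ x _ le_rfl (Steps.iff_iterate.2 rfl))⟩

theorem log_landauBound_le {n : ℕ} (hn : 3 ≤ n) :
    Real.log (landauBound n) ≤
      (2 * (Real.log 4 + 4) + 1) * √((n : ℝ) * Real.log n) := by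
  set s := √((n : ℝ) * Real.log n) with hs
  have hn' : (3 : ℝ) ≤ n := by exact_mod_cast hn
  have hlog : 1 ≤ Real.log n := by
    rw [Real.le_log_iff_exp_le (by linarith)]
    linarith [Real.exp_one_lt_d9]
  have hs1 : 1 ≤ s := Real.one_le_sqrt.2 (by nlinarith)
  have hss : s * s = n * Real.log n := Real.mul_self_sqrt (by positivity)
  set X := ⌊s⌋₊ + 1 with hX
  have hXs : (X : ℝ) ≤ 2 * s := by
    have := Nat.floor_le (zero_le_one.trans hs1)
    push_cast [hX]; linarith
  have hsX : s ≤ X := by push_cast [hX]; exact (Nat.lt_floor_add_one s).le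
  have hC : 0 ≤ Real.log 4 + 4 := by positivity
  have h₁ : Real.log (Nat.lcmUpto X) ≤ (Real.log 4 + 4) * (2 * s) := by
    rw [← Chebyshev.psi_eq_log_lcmUpto]
    exact (Chebyshev.psi_le_const_mul_self (Nat.cast_nonneg X)).trans
      (mul_le_mul_of_nonneg_left hXs hC)
  have h₂ : ((n / X : ℕ) : ℝ) * Real.log n ≤ s := by
    calc ((n / X : ℕ) : ℝ) * Real.log n ≤ (n / X : ℝ) * Real.log n := by
          gcongr; exact Nat.cast_div_le
      _ ≤ (n / s : ℝ) * Real.log n := by gcongr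
      _ = s := by field_simp; rw [sq, hss]
  have hlcm : (Nat.lcmUpto X : ℝ) ≠ 0 := by exact_mod_cast Nat.lcmUpto_ne_zero X
  have hG : Real.log (landauBound n) =
      Real.log (Nat.lcmUpto X) + ((n / X : ℕ) : ℝ) * Real.log n := by
    rw [landauBound, Nat.cast_mul, Nat.cast_pow, Real.log_mul hlcm (by positivity), Real.log_pow]
  rw [hG]
  linarith

theorem landauBound_pos {n : ℕ} (hn : 0 < n) : 0 < landauBound n :=
  Nat.mul_pos (Nat.lcmUpto_pos _) (Nat.pow_pos hn)

theorem isBigO_logb_landauBound :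
    (fun n : ℕ => Real.logb 2 ((55 * n ^ 2 * landauBound n ^ 4 : ℕ) : ℝ)) =O[atTop]
      fun n : ℕ => √((n : ℝ) * Real.log n) := by
  refine IsBigO.of_bound
    ((Real.log 55 + 2 + 4 * (2 * (Real.log 4 + 4) + 1)) / Real.log 2) ?_
  filter_upwards [eventually_ge_atTop 3] with n hn
  have hG := log_landauBound_le hn
  have hGpos := landauBound_pos (show 0 < n by omega)
  have hn' : (3 : ℝ) ≤ n := by exact_mod_cast hn
  have hlog : 1 ≤ Real.log n := by
    rw [Real.le_log_iff_exp_le (by linarith)]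
    linarith [Real.exp_one_lt_d9]
  have hs1 : 1 ≤ √((n : ℝ) * Real.log n) := Real.one_le_sqrt.2 (by nlinarith)
  have hlogs : Real.log n ≤ √((n : ℝ) * Real.log n) := by
    refine Real.le_sqrt_of_sq_le ?_
    have := Real.log_le_self (show (0 : ℝ) ≤ n by linarith)
    nlinarith
  have hge : (1 : ℝ) ≤ ((55 * n ^ 2 * landauBound n ^ 4 : ℕ) : ℝ) := by
    have : 0 < 55 * n ^ 2 * landauBound n ^ 4 := by positivity
    exact_mod_cast this
  rw [Real.norm_of_nonneg (Real.logb_nonneg one_lt_two hge), Real.norm_of_nonneg (by positivity),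
    Real.logb, div_mul_eq_mul_div]
  refine div_le_div_of_nonneg_right ?_ (Real.log_nonneg one_le_two)
  have hG0 : (landauBound n : ℝ) ≠ 0 := by exact_mod_cast hGpos.ne'
  push_cast
  rw [Real.log_mul (by positivity) (by positivity), Real.log_mul (by positivity) (by positivity),
    Real.log_pow, Real.log_pow]
  have : 0 ≤ Real.log 55 := Real.log_nonneg (by norm_num)
  push_cast
  nlinarith

/-! ### Live sets and greedy words -/

namespace DFA

variable {α σ : Type*} (M : DFA α σ)

/-- States from which some word of length `k` is accepted. -/
def live : ℕ → Set σ
  | 0 => M.accept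
  | k + 1 => {q | ∃ a, M.step q a ∈ live k}

theorem mem_live_iff_steps {k : ℕ} {q : σ} :
    q ∈ M.live k ↔ ∃ b ∈ M.accept, Steps (fun x y => ∃ a, M.step x a = y) k q b := by
  induction k generalizing q with
  | zero => simp [live, Steps]
  | succ k ih => simp only [live, Set.mem_ofPred_eq, ih, Steps]; aesop

theorem mem_live_of_mem_acceptsFrom {q : σ} {w : List α} (h : w ∈ M.acceptsFrom q) :
    q ∈ M.live w.length := by
  induction w generalizing q with
  | nil => exact h
  | cons a w ih => exact ⟨a, ih h⟩

theorem live_add_congr {j k : ℕ} (h : M.live j = M.live k) (i : ℕ) :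
    M.live (j + i) = M.live (k + i) := by
  induction i with
  | zero => exact h
  | succ i ih => rw [← Nat.add_assoc, ← Nat.add_assoc, live, live, ih]

/-- Adding `p` to the length only enlarges live sets. Along `n + j * p` this gives an increasing
chain in an `n`-element set; it freezes at its first repetition, since each live set determines the
next. -/
theorem live_eventually_periodic [Fintype σ] [Nonempty σ] :
    ∃ p, 0 < p ∧ p ≤ landauBound (Fintype.card σ) ∧
      ∀ k, Fintype.card σ + Fintype.card σ * p ≤ k → M.live (k + p) = M.live k := by
  obtain ⟨p, hp, hpl, h⟩ := Steps.exists_period fun x y => ∃ a, M.step x a = y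
  refine ⟨p, hp, hpl, fun k hk => ?_⟩
  set n := Fintype.card σ
  have hsub : ∀ k, n ≤ k → M.live k ⊆ M.live (k + p) := by
    intro k hk q hq
    obtain ⟨b, hb, hs⟩ := M.mem_live_iff_steps.1 hq
    exact M.mem_live_iff_steps.2 ⟨b, hb, h k q b hk hs⟩
  have hsub' : ∀ j, M.live (n + j * p) ⊆ M.live (n + (j + 1) * p) := fun j => by
    rw [Nat.succ_mul, ← Nat.add_assoc]
    exact hsub _ (Nat.le_add_right _ _)
  have hmono : Monotone fun j => M.live (n + j * p) := monotone_nat_of_le_succ hsub'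
  have hbase : M.live (n + (n + 1) * p) = M.live (n + n * p) := by
    refine (Set.eq_of_subset_of_ncard_le (hsub' n) (le_of_eq ?_) (Set.toFinite _)).symm
    refine Nat.stabilises_of_monotone (f := fun j => (M.live (n + j * p)).ncard) (b := n)
      (fun i j hij => Set.ncard_le_ncard (hmono hij) (Set.toFinite _))
      (fun j => ?_) (fun j hj => ?_) (Nat.le_succ n)
    · exact (Set.ncard_le_card _).trans Nat.card_eq_fintype_card.le
    · have he := Set.eq_of_subset_of_ncard_le (hsub' j) hj.ge (Set.toFinite _)
      have := M.live_add_congr he p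
      simp only [Nat.add_assoc, ← Nat.succ_mul] at this
      exact congrArg Set.ncard this
  obtain ⟨i, rfl⟩ := Nat.exists_eq_add_of_le hk
  have := M.live_add_congr hbase i
  rwa [Nat.succ_mul, ← Nat.add_assoc, Nat.add_right_comm _ p i] at this

theorem live_add_mul {M : DFA α σ} {T p : ℕ} (hper : ∀ k, T ≤ k → M.live (k + p) = M.live k) {k : ℕ}
    (hk : T ≤ k) (j : ℕ) : M.live (k + j * p) = M.live k := by
  induction j with
  | zero => rw [Nat.zero_mul, Nat.add_zero]
  | succ j ih => rw [Nat.succ_mul, ← Nat.add_assoc, hper _ (by omega), ih]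

variable [Fintype α] [LinearOrder α]

open Classical in
/-- The smallest letter leading from `q` to a state that accepts a word of length `k`, if any. -/
noncomputable def pick (k : ℕ) (q : σ) : Option α :=
  (Finset.univ.filter fun a => M.step q a ∈ M.live k).min

/-- The state reached from `q` after reading `M.pick k q`. -/
noncomputable def next (k : ℕ) (q : σ) : σ := (M.pick k q).elim q (M.step q)

/-- The state reached after `i` greedy steps from `q`, where a word of length `k + i` is sought. -/
noncomputable def greedyState (k : ℕ) : ℕ → σ → σ
  | 0, q => q
  | i + 1, q => greedyState k i (M.next (k + i) q)

/-- The word read during `i` greedy steps from `q`, where a word of length `k + i` is sought. -/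
noncomputable def greedyWord (k : ℕ) : ℕ → σ → List α
  | 0, _ => []
  | i + 1, q => (M.pick (k + i) q).toList ++ greedyWord k i (M.next (k + i) q)

theorem pick_congr {j k : ℕ} (h : M.live j = M.live k) (q : σ) : M.pick j q = M.pick k q := by
  rw [pick, pick, h]

theorem next_congr {j k : ℕ} (h : M.live j = M.live k) (q : σ) : M.next j q = M.next k q := by
  rw [next, next, M.pick_congr h]

/-- The run consults only the sets `live (k + i)`, all determined by `live k`. -/
theorem greedyState_congr {j k : ℕ} (h : M.live j = M.live k) (i : ℕ) (q : σ) :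
    M.greedyState j i q = M.greedyState k i q := by
  induction i generalizing q with
  | zero => rfl
  | succ i ih => rw [greedyState, greedyState, ih, M.next_congr (M.live_add_congr h i)]

theorem greedyWord_congr {j k : ℕ} (h : M.live j = M.live k) (i : ℕ) (q : σ) :
    M.greedyWord j i q = M.greedyWord k i q := by
  induction i generalizing q with
  | zero => rfl
  | succ i ih =>
    have h' := M.live_add_congr h i
    rw [greedyWord, greedyWord, ih, M.next_congr h', M.pick_congr h']

theorem greedyState_add (k i j : ℕ) (q : σ) :
    M.greedyState k (i + j) q = M.greedyState k i (M.greedyState (k + i) j q) := by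
  induction j generalizing q with
  | zero => rfl
  | succ j ih => rw [← Nat.add_assoc, greedyState, ih, greedyState, Nat.add_assoc k]

theorem greedyWord_add (k i j : ℕ) (q : σ) :
    M.greedyWord k (i + j) q =
      M.greedyWord (k + i) j q ++ M.greedyWord k i (M.greedyState (k + i) j q) := by
  induction j generalizing q with
  | zero => rfl
  | succ j ih =>
    rw [← Nat.add_assoc, greedyWord, ih, greedyWord, greedyState, Nat.add_assoc k,
      List.append_assoc]

variable {M}

theorem exists_pick {k : ℕ} {q : σ} (h : q ∈ M.live (k + 1)) :
    ∃ a, M.pick k q = some a ∧ M.next k q = M.step q a ∧ M.step q a ∈ M.live k ∧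
      ∀ b, M.step q b ∈ M.live k → a ≤ b := by
  classical
  obtain ⟨b, hb⟩ := h
  obtain ⟨a, ha⟩ := Finset.min_of_mem
    (s := Finset.univ.filter fun a => M.step q a ∈ M.live k) (a := b) (by simpa using hb)
  have hpick : M.pick k q = some a := by rw [pick]; exact ha
  refine ⟨a, hpick, by rw [next, hpick]; rfl, by simpa using Finset.mem_of_min ha,
    fun c hc => Finset.min_le_of_eq (by simpa using hc) ha⟩

theorem length_greedyWord {k i : ℕ} {q : σ} (h : q ∈ M.live (k + i)) :
    (M.greedyWord k i q).length = i := by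
  induction i generalizing q with
  | zero => rfl
  | succ i ih =>
    obtain ⟨a, hp, hn, hl, -⟩ := exists_pick (k := k + i) h
    rw [greedyWord, List.length_append, ih (hn ▸ hl), hp, Nat.add_comm]
    rfl

theorem greedyWord_isLeast {k : ℕ} {q : σ} (h : q ∈ M.live k) :
    M.greedyWord 0 k q ∈ M.acceptsFrom q ∧ ∀ v ∈ M.acceptsFrom q, v.length = k →
      v = M.greedyWord 0 k q ∨ List.Lex (· < ·) (M.greedyWord 0 k q) v := by
  induction k generalizing q with
  | zero =>
    refine ⟨h, fun v _ hv => Or.inl ?_⟩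
    rw [List.length_eq_zero_iff.1 hv]; rfl
  | succ k ih =>
    obtain ⟨a, hp, hn, hl, hmin⟩ := exists_pick h
    obtain ⟨hacc, hleast⟩ := ih hl
    have hw : M.greedyWord 0 (k + 1) q = a :: M.greedyWord 0 k (M.step q a) := by
      rw [greedyWord, Nat.zero_add, hp, hn]; rfl
    rw [hw]
    refine ⟨hacc, fun v hv hvl => ?_⟩
    cases v with
    | nil => simp at hvl
    | cons b v =>
      have hvk : v.length = k := by simpa using hvl
      have hv : v ∈ M.acceptsFrom (M.step q b) := hv
      have hb : M.step q b ∈ M.live k := hvk ▸ M.mem_live_of_mem_acceptsFrom hv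
      rcases (hmin b hb).lt_or_eq with hab | rfl
      · exact Or.inr (List.Lex.rel hab)
      · rcases hleast v hv hvk with rfl | hlex
        · exact Or.inl rfl
        · exact Or.inr (List.Lex.cons hlex)

theorem mem_smallestWords_iff {u : List α} :
    u ∈ smallestWords M.accepts ↔
      M.start ∈ M.live u.length ∧ u = M.greedyWord 0 u.length M.start := by
  constructor
  · rintro ⟨hu, hmin⟩
    have hl := M.mem_live_of_mem_acceptsFrom hu
    refine ⟨hl, ?_⟩
    obtain ⟨hacc, hleast⟩ := greedyWord_isLeast hl
    have hlen := length_greedyWord (k := 0) (by simpa using hl)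
    refine (hleast u hu rfl).resolve_right fun hlex => ?_
    exact (hmin _ hacc (List.Shortlex.of_lex hlen hlex)).ne hlen
  · rintro ⟨hl, hu⟩
    obtain ⟨hacc, hleast⟩ := greedyWord_isLeast hl
    rw [← hu] at hacc hleast
    refine ⟨hacc, fun v hv hvu => ?_⟩
    rcases List.shortlex_def.1 hvu with h | ⟨hlen, hlex⟩
    · exact h
    · rcases hleast v hv hlen with rfl | hlex'
      · exact absurd hlex (irrefl_of (List.Lex (· < ·)) v)
      · exact absurd hlex' (asymm_of (List.Lex (· < ·)) hlex)

end DFA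

theorem Language.recognizedByDFA_ncard_range_leftQuotient {α : Type*} {L : Language α}
    (h : (Set.range L.leftQuotient).Finite) :
    RecognizedByDFA L (Set.range L.leftQuotient).ncard := by
  have := h.to_subtype
  -- Reindexing by `Fin` brings the state type down to `Type`.
  refine ⟨Fin (Nat.card (Set.range L.leftQuotient)), inferInstance,
    DFA.reindex (Finite.equivFin _) L.toDFA,
    (Fintype.card_fin _).trans (Nat.card_coe_set_eq _), ?_⟩
  rw [DFA.accepts_reindex, Language.accepts_toDFA]

/-! ### Periodicity of greedy runs -/

namespace DFA

variable {α σ : Type*} [Fintype α] [LinearOrder α] {M : DFA α σ}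

theorem greedyState_mul {T p : ℕ} (hper : ∀ k, T ≤ k → M.live (k + p) = M.live k) (j : ℕ) :
    M.greedyState T (j * p) = (M.greedyState T p)^[j] := by
  induction j with
  | zero => rw [Nat.zero_mul]; rfl
  | succ j ih =>
    funext q
    rw [Nat.succ_mul, greedyState_add, M.greedyState_congr (live_add_mul hper le_rfl j), ih,
      Function.iterate_succ_apply]

theorem greedyState_eventually_periodic [Fintype σ] [Nonempty σ] {T p : ℕ} (hp : 0 < p)
    (hper : ∀ k, T ≤ k → M.live (k + p) = M.live k) :
    ∃ c, 0 < c ∧ c ≤ landauBound (Fintype.card σ) ∧ ∀ k, T ≤ k → ∀ q,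
      M.greedyState k (p + Fintype.card σ * p + c * p) q =
        M.greedyState k (p + Fintype.card σ * p) q := by
  obtain ⟨c, hc, hcl, hf⟩ := Function.exists_iterate_period (M.greedyState T p)
  refine ⟨c, hc, hcl, fun k hk q => ?_⟩
  -- Aligning with `T` modulo `p` leaves `p - r` steps before the full blocks and `r` after them:
  -- the extra `p` in the step count.
  obtain ⟨a, r, hr, hkr⟩ : ∃ a r, r ≤ p ∧ k + r = T + a * p := by
    refine ⟨(k - T) / p + 1, p - (k - T) % p, Nat.sub_le _ _, ?_⟩
    have h₁ := Nat.div_add_mod' (k - T) p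
    have h₂ := (Nat.mod_lt (k - T) hp).le
    rw [Nat.succ_mul]
    omega
  have key : ∀ m, M.greedyState k (p + m * p) q =
      M.greedyState k r ((M.greedyState T p)^[m] (M.greedyState (k + r) (p - r) q)) := by
    intro m
    rw [show p + m * p = r + m * p + (p - r) by omega, greedyState_add, greedyState_add,
      ← Nat.add_assoc, M.greedyState_congr (live_add_mul hper (show T ≤ k + r by omega) m),
      M.greedyState_congr (j := k + r) (k := T) (by rw [hkr, live_add_mul hper le_rfl]),
      greedyState_mul hper]
  rw [Nat.add_assoc, ← Nat.add_mul, key, key, hf]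

/-! ### Cutting out a period and counting quotients -/

section Cut

variable {T P D : ℕ} (hper : ∀ k, T ≤ k → M.live (k + P) = M.live k)
  (hstate : ∀ k, T ≤ k → ∀ q, M.greedyState k (D + P) q = M.greedyState k D q)

include hper hstate

/-- Both words start with `W`, as their live sets agree. The longer run after `D + P` letters and
the shorter one after `D` are in the same state with `k + P` letters to go, so they share the tail
`Z`. -/
theorem greedyWord_add_period {k : ℕ} (hk : T ≤ k) (hl : M.start ∈ M.live (k + (D + P))) :
    ∃ W Z : List α, W.length = D + P ∧
      M.greedyWord 0 (k + (D + P) + P) M.start = W ++ Z ∧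
      M.greedyWord 0 (k + (D + P)) M.start = W.take D ++ Z ∧
      (M.greedyWord 0 (k + (D + P)) M.start).take (D + P) = W := by
  have hW : ∀ q, M.greedyWord (k + P) (D + P) q = M.greedyWord k (D + P) q :=
    M.greedyWord_congr (hper k hk) (D + P)
  have hlen := length_greedyWord hl
  have hlenD : (M.greedyWord (k + P + P) D M.start).length = D :=
    length_greedyWord (by rw [show k + P + P + D = k + (D + P) + P by omega,
      hper _ (by omega)]; exact hl)
  have hWD : (M.greedyWord k (D + P) M.start).take D = M.greedyWord (k + P) D M.start := by
    rw [← hW, Nat.add_comm D P, greedyWord_add, List.take_left' hlenD]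
    exact M.greedyWord_congr (hper _ (by omega)) D M.start
  refine ⟨M.greedyWord k (D + P) M.start,
    M.greedyWord 0 (k + P) (M.greedyState (k + P) D M.start), hlen, ?_, ?_, ?_⟩
  · rw [show k + (D + P) + P = k + P + (D + P) by omega, greedyWord_add, Nat.zero_add, hW,
      hstate _ (by omega)]
  · rw [show k + (D + P) = k + P + D by omega, greedyWord_add, Nat.zero_add, hWD]
  · rw [greedyWord_add, Nat.zero_add, List.take_left' hlen]

theorem mem_smallestWords_iff_cut {u : List α} (hu : T + (D + P) + P ≤ u.length) :
    u ∈ smallestWords M.accepts ↔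
      u.take D ++ u.drop (D + P) ∈ smallestWords M.accepts ∧
        u.take (D + P) = (u.take D ++ u.drop (D + P)).take (D + P) := by
  obtain ⟨k, hk, hlen⟩ : ∃ k, T ≤ k ∧ u.length = k + (D + P) + P :=
    ⟨u.length - (D + P + P), by omega, by omega⟩
  have hcut : (u.take D ++ u.drop (D + P)).length = k + (D + P) := by
    simp only [List.length_append, List.length_take, List.length_drop]; omega
  rw [mem_smallestWords_iff, mem_smallestWords_iff, hlen, hcut, hper _ (by omega), and_assoc]
  refine and_congr_right fun hl => ?_
  obtain ⟨W, Z, hW, h₁, h₂, h₃⟩ := greedyWord_add_period hper hstate hk hl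
  rw [h₁]
  constructor
  · rintro rfl
    have hc : (W ++ Z).take D ++ (W ++ Z).drop (D + P) =
        M.greedyWord 0 (k + (D + P)) M.start := by
      rw [h₂, List.drop_left' hW, List.take_append_of_le_length (by omega)]
    refine ⟨hc, ?_⟩
    rw [hc, h₃, List.take_left' hW]
  · rintro ⟨hc, ht⟩
    rw [hc, h₃] at ht
    rw [h₂] at hc
    have hlenD : (u.take D).length = (W.take D).length := by
      simp only [List.length_take]; omega
    rw [← List.take_append_drop (D + P) u, ht, (List.append_inj hc hlenD).2]

/-- For long `w` the cut and the prefix test take place inside `w`: if the test fails no extension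
works, otherwise the cut word has the same quotient. -/
theorem exists_short_leftQuotient_eq (hP : 0 < P) (w : List α) :
    (smallestWords M.accepts).leftQuotient w = (∅ : Set (List α)) ∨
      ∃ w' : List α, w'.length < T + (D + P) + P ∧
        (smallestWords M.accepts).leftQuotient w' = (smallestWords M.accepts).leftQuotient w := by
  induction hn : w.length using Nat.strong_induction_on generalizing w with
  | _ n ih =>
    subst hn
    by_cases hw : w.length < T + (D + P) + P
    · exact Or.inr ⟨w, hw, rfl⟩
    push Not at hw
    have hiff : ∀ v, w ++ v ∈ smallestWords M.accepts ↔
        (w.take D ++ w.drop (D + P)) ++ v ∈ smallestWords M.accepts ∧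
          w.take (D + P) = (w.take D ++ w.drop (D + P)).take (D + P) := by
      intro v
      have hcut : D + P ≤ (w.take D ++ w.drop (D + P)).length := by
        simp only [List.length_append, List.length_take, List.length_drop]; omega
      rw [mem_smallestWords_iff_cut hper hstate (u := w ++ v) (by rw [List.length_append]; omega),
        List.take_append_of_le_length (by omega), List.take_append_of_le_length (by omega),
        List.drop_append_of_le_length (by omega), ← List.append_assoc,
        List.take_append_of_le_length hcut]
    by_cases ht : w.take (D + P) = (w.take D ++ w.drop (D + P)).take (D + P)
    · have heq : (smallestWords M.accepts).leftQuotient (w.take D ++ w.drop (D + P)) =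
          (smallestWords M.accepts).leftQuotient w :=
        Set.ext fun v => ((hiff v).trans (and_iff_left ht)).symm
      rw [← heq]
      exact ih _ (by simp only [List.length_append, List.length_take, List.length_drop]; omega)
        _ rfl
    · exact Or.inl (Set.eq_empty_of_forall_notMem fun v hv => ht ((hiff v).1 hv).2)

-- Shortening the unread part by `P` leaves the greedy prefix unchanged.
omit hstate in
theorem exists_greedyWord_prefix (hP : 0 < P) {w v : List α}
    (h : w ++ v ∈ smallestWords M.accepts) :
    ∃ N < T + P + w.length, w = (M.greedyWord 0 N M.start).take w.length := by
  obtain ⟨hl, hw⟩ := mem_smallestWords_iff.1 h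
  have hw : w = (M.greedyWord 0 (v.length + w.length) M.start).take w.length := by
    rw [Nat.add_comm, ← List.length_append, ← hw, List.take_left]
  rw [List.length_append, Nat.add_comm] at hl
  generalize v.length = k at hl hw
  induction k using Nat.strong_induction_on with
  | _ k ih =>
    by_cases hk : k < T + P
    · exact ⟨_, by omega, hw⟩
    obtain ⟨j, hj, rfl⟩ : ∃ j, T ≤ j ∧ k = j + P := ⟨k - P, by omega, by omega⟩
    have hl' : M.start ∈ M.live (j + w.length) := by
      rwa [Nat.add_right_comm, hper _ (by omega)] at hl
    refine ih j (by omega) hl' ?_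
    rw [greedyWord_add, List.take_left' (length_greedyWord (by simpa using hl)), Nat.zero_add,
      M.greedyWord_congr (hper j hj)] at hw
    rw [greedyWord_add, List.take_left' (length_greedyWord (by simpa using hl')), Nat.zero_add]
    exact hw

theorem ncard_range_leftQuotient_smallestWords_le (hP : 0 < P) :
    (Set.range (smallestWords M.accepts).leftQuotient).Finite ∧
      (Set.range (smallestWords M.accepts).leftQuotient).ncard ≤
        (T + (D + P) + P) * (T + P + (T + (D + P) + P)) + 1 := by
  classical
  set B := T + (D + P) + P
  let F : Finset (Language α) := insert (∅ : Set (List α))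
    ((Finset.range B ×ˢ Finset.range (T + P + B)).image fun x =>
      (smallestWords M.accepts).leftQuotient ((M.greedyWord 0 x.2 M.start).take x.1))
  have hsub : Set.range (smallestWords M.accepts).leftQuotient ⊆ F := by
    rintro _ ⟨w, rfl⟩
    rcases exists_short_leftQuotient_eq hper hstate hP w with h | ⟨w', hw', h⟩
    · rw [h]; exact Finset.mem_insert_self _ _
    · rw [← h]
      rcases Set.eq_empty_or_nonempty
        ((smallestWords M.accepts).leftQuotient w' : Set (List α)) with he | ⟨v, hv⟩
      · rw [he]; exact Finset.mem_insert_self _ _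
      · obtain ⟨N, hN, hwN⟩ := exists_greedyWord_prefix hper hP hv
        refine Finset.mem_insert_of_mem (Finset.mem_image.2 ⟨(w'.length, N), ?_, ?_⟩)
        · exact Finset.mem_product.2 ⟨Finset.mem_range.2 hw', Finset.mem_range.2 (by omega)⟩
        · exact congrArg _ hwN.symm
  refine ⟨F.finite_toSet.subset hsub, ?_⟩
  calc _ ≤ F.card := by
        rw [← Set.ncard_coe_finset]; exact Set.ncard_le_ncard hsub F.finite_toSet
    _ ≤ _ := (Finset.card_insert_le _ _).trans
        (Nat.succ_le_succ (Finset.card_image_le.trans (by simp)))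

end Cut

theorem smallestWords_ncard_le [Fintype σ] (M : DFA α σ) :
    (Set.range (smallestWords M.accepts).leftQuotient).Finite ∧
      (Set.range (smallestWords M.accepts).leftQuotient).ncard ≤
        55 * Fintype.card σ ^ 2 * landauBound (Fintype.card σ) ^ 4 := by
  have : Nonempty σ := ⟨M.start⟩
  obtain ⟨p, hp, hpG, hper⟩ := M.live_eventually_periodic
  obtain ⟨c, hc, hcG, hstate⟩ := greedyState_eventually_periodic hp hper
  obtain ⟨hfin, hle⟩ := ncard_range_leftQuotient_smallestWords_le
    (fun k hk => live_add_mul hper hk c) hstate (Nat.mul_pos hc hp)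
  refine ⟨hfin, hle.trans ?_⟩
  have hn : 1 ≤ Fintype.card σ := Fintype.card_pos
  generalize Fintype.card σ = n at hn hpG hcG ⊢
  generalize landauBound n = G at hpG hcG
  have hG : 1 ≤ G := hp.trans_le hpG
  have hcp : c * p ≤ n * G ^ 2 := by
    calc c * p ≤ G * G := Nat.mul_le_mul hcG hpG
      _ = 1 * G ^ 2 := by ring
      _ ≤ n * G ^ 2 := Nat.mul_le_mul_right _ hn
  have hGG : G ≤ G ^ 2 := Nat.le_self_pow two_ne_zero G
  have hnp : n * p ≤ n * G ^ 2 := Nat.mul_le_mul_left n (hpG.trans hGG)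
  have hp' : p ≤ n * G ^ 2 := (Nat.le_mul_of_pos_left p hn).trans hnp
  have hn' : n ≤ n * G ^ 2 := Nat.le_mul_of_pos_right n (by positivity)
  have h1 : 1 ≤ n * G ^ 2 := hn.trans hn'
  rw [show 55 * n ^ 2 * G ^ 4 = 55 * ((n * G ^ 2) * (n * G ^ 2)) by ring]
  generalize n * G ^ 2 = R at *
  -- Here `T` and `D` are at most `2 * R` and `P ≤ R`.
  calc _ ≤ (6 * R) * (9 * R) + 1 := by gcongr <;> omega
    _ ≤ 55 * (R * R) := by nlinarith

end DFA

theorem mainTheorem1 :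
    ∃ f : ℕ → ℝ,
      f =O[atTop] (fun n : ℕ => Real.sqrt ((n : ℝ) * Real.log (n : ℝ))) ∧
      ∀ (α : Type*) [Fintype α] [LinearOrder α] (n : ℕ) (L : Language α),
        RecognizedByDFA L n →
          ∃ m : ℕ, (m : ℝ) ≤ (2 : ℝ) ^ (f n) ∧ RecognizedByDFA (smallestWords L) m := by
  refine ⟨_, isBigO_logb_landauBound, ?_⟩
  rintro α _ _ _ _ ⟨σ, _, M, rfl, rfl⟩
  obtain ⟨hfin, hle⟩ := M.smallestWords_ncard_le
  refine ⟨_, ?_, Language.recognizedByDFA_ncard_range_leftQuotient hfin⟩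
  have : Nonempty σ := ⟨M.start⟩
  have hn : 0 < Fintype.card σ := Fintype.card_pos
  have hG := landauBound_pos hn
  rw [Real.rpow_logb two_pos (by norm_num) (by positivity)]
  exact_mod_cast hle
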